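/- Let $\sigma_{or}^Z$ be the first-order signature (with equality) with constants $0,1$, binary function symbols $+,\cdot$, a binary relation symbol $\le$ and a unary relation symbol $\mathit{Int}$. For $n\in\mathbb N$ write $nx$ for the $n$-fold sum $x+\dots+x$, and for $m\in\mathbb Z$ read $0\le t+m$ as $m^-\cdot 1\le t+m^+\cdot 1$, where $m^+=\max(m,0)$ and $m^-=\max(-m,0)$. Let $\mathbf{LIRR}$ be the $\sigma_{or}^Z$-theory with the following axioms: * the commutative ring axioms: associativity and commutativity of $+$ and $\cdot$, $x+0=x$, $x\cdot 1=x$, $x\cdot(y+z)=x\cdot y+x\cdot z$, and $\forall x\,\exists y.\ x+y=0$; * $\le$ is reflexive, transitive and antisymmetric, and $x\le y\Rightarrow x+z\le y+z$; * $0\le 1\wedge 0\ne 1$; * for every integer $n\ge 1$: $\exists x.\ nx=1$, and $\forall x.\ 0\le nx\Rightarrow 0\le x$; * $\mathit{Int}(1)$; $\ \mathit{Int}(x)\wedge\mathit{Int}(y)\Rightarrow\mathit{Int}(x+y)$; $\ \mathit{Int}(x)\wedge x+y=0\Rightarrow\mathit{Int}(y)$; * for all integers $n\ge 1$ and $m$: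 $\forall x.\ \mathit{Int}(x)\wedge 0\le nx+m\Rightarrow 0\le x+\lfloor m/n\rfloor$. Regard $\mathbb R$ as a $\sigma_{or}^Z$-structure in the usual way, with $\mathit{Int}$ interpreted as the set of integers, and let $\mathit{Th}^Z(\mathbb R)$ be the set of all $\sigma_{or}^Z$-sentences true in $\mathbb R$. Let $X$ be any set of new constant symbols. A sentence $F$ over $\sigma_{or}^Z(X)$ is satisfiable modulo a $\sigma_{or}^Z$-theory $T$ if some $\sigma_{or}^Z(X)$-structure satisfies $T$ and $F$. **Theorem.** Let $F$ be a ground (variable- and quantifier-free) formula over $\sigma_{or}^Z(X)$ that is free of negation and of multiplication, i.e. $F$ is built by $\wedge$ and $\vee$ from $\top$, $\bot$ and atoms $s=t$, $s\le t$, $\mathit{Int}(t)$, whose terms are built from $0$, $1$ and symbols of $X$ by $+$. Then $F$ is satisfiable modulo $\mathbf{LIRR}$ if and only if $F$ is satisfiable modulo $\mathit{Th}^Z(\mathbb R)$; and this is the case if and only if $F$ holds in $\mathbb R$ for some interpretation of the symbols of $X$ by real numbers. -/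

import Mathlib

namespace LIRing

open FirstOrder FirstOrder.Language

universe u

/-- Function symbols of the signature of ordered rings: `0`, `1`, `+`, `·`. -/
inductive Fn : ℕ → Type
  | zero : Fn 0
  | one : Fn 0
  | add : Fn 2
  | mul : Fn 2

/-- Relation symbols: the binary `≤` and the unary `Int` (equality is a logical symbol). -/
inductive Rl : ℕ → Type
  | le : Rl 2
  | int : Rl 1

/-- The signature of ordered rings extended with the unary relation symbol `Int`. -/
def sig : FirstOrder.Language.{0, 0} := ⟨Fn, Rl⟩

abbrev zeroSym : sig.Constants := Fn.zero
abbrev oneSym : sig.Constants := Fn.one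
abbrev addSym : sig.Functions 2 := Fn.add
abbrev mulSym : sig.Functions 2 := Fn.mul
abbrev leSym : sig.Relations 2 := Rl.le
abbrev intSym : sig.Relations 1 := Rl.int

/-! ### Terms and atomic formulas of the signature -/

section Terms

variable {α : Type u} {n : ℕ}

instance : Zero (sig.Term α) := ⟨zeroSym.term⟩
instance : One (sig.Term α) := ⟨oneSym.term⟩
instance : Add (sig.Term α) := ⟨fun s t => addSym.apply₂ s t⟩
instance : Mul (sig.Term α) := ⟨fun s t => mulSym.apply₂ s t⟩

/-- The term `t + ⋯ + t` (`n` summands). -/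
def nsum : ℕ → sig.Term α → sig.Term α
  | 0, _ => 0
  | k + 1, t => nsum k t + t

/-- The atomic formula `s ≤ t`. -/
def leF (s t : sig.Term (α ⊕ Fin n)) : sig.BoundedFormula α n :=
  leSym.boundedFormula₂ s t

/-- The atomic formula `Int(t)`. -/
def intF (t : sig.Term (α ⊕ Fin n)) : sig.BoundedFormula α n :=
  intSym.boundedFormula₁ t

/-- The formula `0 ≤ t + m` for an integer constant `m`. The signature has no subtraction, so
this is written `m⁻ ≤ t + m⁺`, where `m⁺ = max m 0` and `m⁻ = max (-m) 0`. -/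
def nonnegAddConst (t : sig.Term (α ⊕ Fin n)) (m : ℤ) : sig.BoundedFormula α n :=
  leF (nsum (-m).toNat 1) (t + nsum m.toNat 1)

end Terms

/-! ### The axioms -/

/-- The commutative ring axioms. -/
def commRingAxioms : sig.Theory :=
  { ∀' ∀' ∀' ((&0 + (&1 + &2)) =' ((&0 + &1) + &2)),
    ∀' ∀' ∀' ((&0 * (&1 * &2)) =' ((&0 * &1) * &2)),
    ∀' ∀' ((&0 + &1) =' (&1 + &0)),
    ∀' ∀' ((&0 * &1) =' (&1 * &0)),
    ∀' ((&0 + 0) =' &0),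
    ∀' ((&0 * 1) =' &0),
    ∀' ∀' ∀' ((&0 * (&1 + &2)) =' ((&0 * &1) + (&0 * &2))),
    ∀' ∃' ((&0 + &1) =' 0) }

/-- Reflexivity, transitivity, antisymmetry of `≤`, its compatibility with addition, and
non-triviality. -/
def orderAxioms : sig.Theory :=
  { ∀' leF (&0) (&0),
    ∀' ∀' ∀' ((leF (&0) (&1) ⊓ leF (&1) (&2)) ⟹ leF (&0) (&2)),
    ∀' ∀' ((leF (&0) (&1) ⊓ leF (&1) (&0)) ⟹ (&0 =' &1)),
    ∀' ∀' ∀' (leF (&0) (&1) ⟹ leF (&0 + &2) (&1 + &2)),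
    leF 0 1 ⊓ ∼(0 =' 1) }

/-- Divisibility: `∃ x, x + ⋯ + x = 1` (`n` summands). -/
def divisibility (n : ℕ) : sig.Sentence :=
  ∃' (nsum n (&0) =' 1)

/-- Perforation-freeness: `∀ x, 0 ≤ x + ⋯ + x → 0 ≤ x` (`n` summands). -/
def perforationFree (n : ℕ) : sig.Sentence :=
  ∀' (leF 0 (nsum n (&0)) ⟹ leF 0 (&0))

/-- The theory of linear real rings, in the signature with `Int` (which it does not mention). -/
def LRR : sig.Theory :=
  commRingAxioms ∪ orderAxioms ∪ {φ | ∃ n : ℕ, 1 ≤ n ∧ φ = divisibility n} ∪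
    {φ | ∃ n : ℕ, 1 ≤ n ∧ φ = perforationFree n}

/-- `Int` holds of `1` and is closed under addition and under additive inverses. -/
def intAxioms : sig.Theory :=
  { intF 1,
    ∀' ∀' ((intF (&0) ⊓ intF (&1)) ⟹ intF (&0 + &1)),
    ∀' ∀' ((intF (&0) ⊓ ((&0 + &1) =' 0)) ⟹ intF (&1)) }

/-- Cutting plane: `∀ x, Int(x) ∧ 0 ≤ n x + m → 0 ≤ x + ⌊m / n⌋`. -/
def cuttingPlane (n : ℕ) (m : ℤ) : sig.Sentence :=
  ∀' ((intF (&0) ⊓ nonnegAddConst (nsum n (&0)) m) ⟹ nonnegAddConst (&0) ⌊(m : ℚ) / (n : ℚ)⌋)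

/-- The theory of linear integer/real rings. -/
def LIRR : sig.Theory :=
  LRR ∪ intAxioms ∪ {φ | ∃ (n : ℕ) (m : ℤ), 1 ≤ n ∧ φ = cuttingPlane n m}

/-! ### The reals -/

/-- The standard structure on `ℝ`, with `Int` interpreted as the set of integers. -/
instance realStructure : sig.Structure ℝ where
  funMap := fun f x =>
    match f, x with
    | Fn.zero, _ => 0
    | Fn.one, _ => 1
    | Fn.add, x => x 0 + x 1
    | Fn.mul, x => x 0 * x 1
  RelMap := fun R x =>
    match R, x with
    | Rl.le, x => x 0 ≤ x 1
    | Rl.int, x => ∃ k : ℤ, (k : ℝ) = x 0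

/-- The theory of all sentences that hold in `ℝ`. -/
def realTheory : sig.Theory := sig.completeTheory ℝ

/-! ### Ground formulas -/

section Ground

variable {X : Type u}

/-- Terms over `sig` with additional constant symbols `X` in which `·` does not occur. -/
inductive TermMulFree {α : Type*} : (sig[[X]]).Term α → Prop
  | var (a : α) : TermMulFree (Term.var a)
  | const (x : X) : TermMulFree (Constants.term (sig.con x))
  | zero : TermMulFree (Constants.term ((sig.lhomWithConstants X).onFunction zeroSym))
  | one : TermMulFree (Constants.term ((sig.lhomWithConstants X).onFunction oneSym))
  | add {s t : (sig[[X]]).Term α} (hs : TermMulFree s) (ht : TermMulFree t) :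
      TermMulFree (Functions.apply₂ ((sig.lhomWithConstants X).onFunction addSym) s t)

/-- Formulas in which `·` does not occur. -/
def MulFree {α : Type*} : ∀ {n : ℕ}, (sig[[X]]).BoundedFormula α n → Prop
  | _, .falsum => True
  | _, .equal s t => TermMulFree s ∧ TermMulFree t
  | _, .rel _ ts => ∀ i, TermMulFree (ts i)
  | _, .imp φ ψ => MulFree φ ∧ MulFree ψ
  | _, .all φ => MulFree φ

/-- Quantifier-free formulas without negation: those built from atomic formulas (`s = t`,
`s ≤ t`, `Int(t)`), `⊤` and `⊥` by conjunction and disjunction. -/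
inductive IsQFNegFree {α : Type*} {n : ℕ} : (sig[[X]]).BoundedFormula α n → Prop
  | atom {φ : (sig[[X]]).BoundedFormula α n} (h : φ.IsAtomic) : IsQFNegFree φ
  | bot : IsQFNegFree ⊥
  | top : IsQFNegFree ⊤
  | and {φ ψ : (sig[[X]]).BoundedFormula α n} (hφ : IsQFNegFree φ) (hψ : IsQFNegFree ψ) :
      IsQFNegFree (φ ⊓ ψ)
  | or {φ ψ : (sig[[X]]).BoundedFormula α n} (hφ : IsQFNegFree φ) (hψ : IsQFNegFree ψ) :
      IsQFNegFree (φ ⊔ ψ)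

/-- `F` is satisfiable modulo the `sig`-theory `T`: some structure over `sig` with the additional
constant symbols `X` satisfies every sentence of `T` as well as `F`. -/
def SatisfiableModulo (T : sig.Theory) (F : (sig[[X]]).Sentence) : Prop :=
  ((sig.lhomWithConstants X).onTheory T ∪ {F}).IsSatisfiable

/-- `F` holds in `ℝ` for some interpretation of the constant symbols `X` by real numbers. -/
def SatisfiableInReals (F : (sig[[X]]).Sentence) : Prop :=
  ∃ v : X → ℝ, letI := constantsOn.structure v; ℝ ⊨ F

end Ground

end LIRing

/-! Since `LIRR` holds in `ℝ`, the content is to pass from a model `M` of `LIRR` satisfying `F` to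
real values for the constants. Divisibility makes `M` a `ℚ`-algebra, perforation-freeness makes its
nonnegative elements a rational cone, and the cutting plane axioms close this cone under rounding
(`IsLinearIntegerRealRing.isCuttingCone`). As `F` is negation-free, its truth in `M` rests on
finitely many facts `0 ≤ s` and `Int(t)`. As `F` is multiplication-free, a `ℚ`-linear `φ : M → ℚ`
with `φ 1 = 1` that preserves these facts carries `F` over to `ℝ` (`exists_finset_realize`).

Such a `φ` exists by `IsCuttingCone.exists_linearMap`. Enlarge the cone to a maximal cutting cone
`Q`, and let `B` be the subspace of elements bounded by multiples of `1`. Maximality forces each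
integral element of `B` to equal an integer modulo `Q ∩ -Q`, so on `B` Farkas' lemma gives a
functional with the right signs and integral values. The image of `Q` in `M ⧸ B` contains no line,
so Gordan's theorem gives a functional strictly positive on the finitely many unbounded `s`. A
section of `M → M ⧸ B` compatible with integrality glues the two, the second taken with a large
integer weight. -/

namespace LIRing

open FirstOrder FirstOrder.Language

universe u

/-! ### Separation for finitely generated rational cones -/

section Cones

variable {V : Type*} [AddCommGroup V] [Module ℚ V]

/-- Farkas' lemma over `ℚ`. -/
theorem exists_linearMap_of_notMem_hull {ι : Type*} (S : Finset ι) (f : ι → V) (x : V)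
    (hx : x ∉ PointedCone.hull ℚ (f '' S)) :
    ∃ φ : V →ₗ[ℚ] ℚ, (∀ i ∈ S, 0 ≤ φ (f i)) ∧ φ x < 0 := by
  classical
  induction S using Finset.induction_on generalizing f x with
  | empty =>
    have hx0 : x ≠ 0 := fun h => hx (h ▸ zero_mem _)
    obtain ⟨φ, hφ⟩ := Module.Projective.exists_dual_ne_zero ℚ hx0
    rcases hφ.lt_or_gt with h | h
    · exact ⟨φ, by simp, h⟩
    · exact ⟨-φ, by simp, by simpa using h⟩
  | insert a S ha ih =>
    have hS : ∀ i ∈ S, f i ∈ PointedCone.hull ℚ (f '' ↑(insert a S)) := fun i hi =>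
      Submodule.subset_span ⟨i, by simp [hi], rfl⟩
    have haS : f a ∈ PointedCone.hull ℚ (f '' ↑(insert a S)) :=
      Submodule.subset_span ⟨a, by simp, rfl⟩
    obtain ⟨φ, hφ, hφx⟩ := ih f x fun h => hx <|
      Submodule.span_mono (Set.image_mono (by simp)) h
    by_cases hφa : 0 ≤ φ (f a)
    · exact ⟨φ, by simpa using ⟨hφa, hφ⟩, hφx⟩
    push Not at hφa
    -- The projection along `f a` onto the kernel of `φ`. The signs of `φ` make each `π (f i)` and
    -- also `x - π x` nonnegative combinations of generators, so `π x` stays outside the projected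
    -- cone; a functional composed with `π` vanishes at `f a`.
    let π : V →ₗ[ℚ] V := LinearMap.id - ((φ (f a))⁻¹ • φ).smulRight (f a)
    have hπ : ∀ v, π v = v - ((φ (f a))⁻¹ * φ v) • f a := fun v => by simp [π]
    obtain ⟨ψ, hψ, hψx⟩ := ih (fun i => π (f i)) (π x) fun h => by
      refine hx ?_
      have hle : PointedCone.hull ℚ ((fun i => π (f i)) '' ↑S) ≤
          PointedCone.hull ℚ (f '' ↑(insert a S)) := by
        refine Submodule.span_le.2 ?_
        rintro _ ⟨i, hi, rfl⟩
        have := add_mem (hS i hi) (PointedCone.smul_mem _ (r := -((φ (f a))⁻¹ * φ (f i)))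
          (by have := mul_nonpos_of_nonpos_of_nonneg (inv_nonpos.2 hφa.le) (hφ i hi); linarith) haS)
        rw [neg_smul, ← sub_eq_add_neg] at this
        simpa [hπ] using this
      have := add_mem (hle h) (PointedCone.smul_mem _ (r := (φ (f a))⁻¹ * φ x)
        (mul_nonneg_of_nonpos_of_nonpos (inv_nonpos.2 hφa.le) hφx.le) haS)
      simpa [hπ] using this
    have hπa : π (f a) = 0 := by simp [hπ, hφa.ne]
    exact ⟨ψ ∘ₗ π, by simpa [hπa] using hψ, hψx⟩

/-- Gordan's theorem over `ℚ`. -/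
theorem exists_linearMap_pos (S : Finset V) (hS : ∀ x ∈ S, -x ∉ PointedCone.hull ℚ (S : Set V)) :
    ∃ φ : V →ₗ[ℚ] ℚ, ∀ x ∈ S, 0 < φ x := by
  have H : ∀ x ∈ S, ∃ φ : V →ₗ[ℚ] ℚ, (∀ y ∈ S, 0 ≤ φ y) ∧ 0 < φ x := fun x hx => by
    obtain ⟨φ, h1, h2⟩ := exists_linearMap_of_notMem_hull S id (-x) (by simpa using hS x hx)
    exact ⟨φ, h1, by simpa using h2⟩
  choose! φ h1 h2 using H
  refine ⟨∑ x ∈ S, φ x, fun x hx => ?_⟩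
  rw [LinearMap.sum_apply]
  exact Finset.sum_pos' (fun y hy => h1 y hy x hx) ⟨x, hx, h2 x hx⟩

/-! ### Cones closed under rounding -/

/-- A proper rational cone containing `u` and closed under the cutting plane rule for the
elements of `L`. -/
structure IsCuttingCone (L : AddSubgroup V) (u : V) (P : PointedCone ℚ V) : Prop where
  unit_mem : u ∈ P
  neg_unit_notMem : -u ∉ P
  round : ∀ w ∈ L, ∀ q : ℚ, w + q • u ∈ P → w + (⌊q⌋ : ℚ) • u ∈ P

variable {L : AddSubgroup V} {u : V} {P : PointedCone ℚ V}

lemma IsCuttingCone.nonneg_of_smul_mem (h : IsCuttingCone L u P) {c : ℚ} (hc : c • u ∈ P) :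
    0 ≤ c := by
  by_contra! hlt
  refine h.neg_unit_notMem ?_
  have := PointedCone.smul_mem P (r := (-c)⁻¹) (by simpa using hlt.le) hc
  rwa [smul_smul, inv_neg, neg_mul, inv_mul_cancel₀ hlt.ne, neg_one_smul] at this

/-- Zorn's lemma: each condition on a cutting cone involves one membership at a time, so it passes
to the union of a chain. -/
lemma IsCuttingCone.exists_maximal (h : IsCuttingCone L u P) :
    ∃ Q, P ≤ Q ∧ Maximal (IsCuttingCone L u) Q := by
  refine zorn_le_nonempty₀ {Q | IsCuttingCone L u Q} (fun c hc hchain Q hQ => ?_) P h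
  have hmem : ∀ x, x ∈ sSup c ↔ ∃ R ∈ c, x ∈ R := fun x =>
    Submodule.mem_sSup_of_directed ⟨Q, hQ⟩ hchain.directedOn
  refine ⟨sSup c, ⟨(hmem _).2 ⟨Q, hQ, (hc hQ).unit_mem⟩, fun hu => ?_, fun w hw q hq => ?_⟩,
    fun R hR => le_sSup hR⟩
  · obtain ⟨R, hR, hu⟩ := (hmem _).1 hu
    exact (hc hR).neg_unit_notMem hu
  · obtain ⟨R, hR, hq⟩ := (hmem _).1 hq
    exact (hmem _).2 ⟨R, hR, (hc hR).round w hw q hq⟩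

/-- The cone generated by `P` and `-a`. -/
def adjoinNeg (P : PointedCone ℚ V) (a : V) : PointedCone ℚ V where
  carrier := {x | ∃ c : ℚ, 0 ≤ c ∧ x + c • a ∈ P}
  zero_mem' := ⟨0, le_rfl, by simp⟩
  add_mem' := by
    rintro x y ⟨c, hc, hx⟩ ⟨d, hd, hy⟩
    refine ⟨c + d, add_nonneg hc hd, ?_⟩
    rw [add_smul, add_add_add_comm]
    exact add_mem hx hy
  smul_mem' := by
    rintro ⟨r, hr⟩ x ⟨c, hc, hx⟩
    refine ⟨r * c, mul_nonneg hr hc, ?_⟩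
    have := PointedCone.smul_mem P hr hx
    rwa [smul_add, smul_smul] at this

/-- If `k` is the least integer upper bound of `w`, then `w ≥ k` can be added consistently. -/
lemma IsCuttingCone.adjoinNeg (h : IsCuttingCone L u P) (hu : u ∈ L) {w : V} (hw : w ∈ L) {k : ℤ}
    (hk : (k : ℚ) • u - w ∈ P) (hmin : ((k - 1 : ℤ) : ℚ) • u - w ∉ P) :
    IsCuttingCone L u (adjoinNeg P ((k : ℚ) • u - w)) := by
  have haL : (k : ℚ) • u - w ∈ L := by
    rw [Int.cast_smul_eq_zsmul]
    exact sub_mem (zsmul_mem hu k) hw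
  set a := (k : ℚ) • u - w with ha
  refine ⟨⟨0, le_rfl, by simpa using h.unit_mem⟩, ?_, ?_⟩
  · rintro ⟨c, hc, hmem⟩
    rcases hc.eq_or_lt with rfl | hc
    · exact h.neg_unit_notMem (by simpa using hmem)
    have h1 := PointedCone.smul_mem P (inv_nonneg.2 hc.le) hmem
    have h2 : a + (-c⁻¹) • u ∈ P := by
      convert h1 using 1
      rw [smul_add, smul_smul, inv_mul_cancel₀ hc.ne']
      module
    have h3 := h.round a haL _ h2
    refine hmin ?_
    have hfl : (⌊-c⁻¹⌋ : ℚ) ≤ -1 := by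
      have : ⌊-c⁻¹⌋ < 0 := Int.floor_lt.2 (by simpa using hc)
      exact_mod_cast Int.le_sub_one_of_lt this
    have h4 := add_mem h3 (PointedCone.smul_mem P (r := -1 - (⌊-c⁻¹⌋ : ℚ)) (by linarith) h.unit_mem)
    convert h4 using 1
    rw [ha]
    push_cast
    module
  · rintro v hv q ⟨c, hc, hmem⟩
    -- As `a` is in `P`, the coefficient `c` may be raised to a natural number, which keeps `v + j
    -- a` in `L` and lets `P` itself do the rounding.
    obtain ⟨j, hj⟩ := exists_nat_ge c
    have h1 := add_mem hmem (PointedCone.smul_mem P (sub_nonneg.2 hj) hk)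
    have h2 : (v + (j : ℚ) • a) + q • u ∈ P := by
      convert h1 using 1
      module
    have h3 := h.round _ (add_mem hv (by rw [Nat.cast_smul_eq_nsmul]; exact nsmul_mem haL j)) q h2
    refine ⟨j, by positivity, ?_⟩
    convert h3 using 1
    module

/-- The elements lying between two rational multiples of `u`. -/
def boundedElements (P : PointedCone ℚ V) (u : V) : Submodule ℚ V where
  carrier := {v | ∃ c : ℚ, c • u - v ∈ P ∧ c • u + v ∈ P}
  zero_mem' := ⟨0, by simp, by simp⟩
  add_mem' := by
    rintro x y ⟨c, hc, hc'⟩ ⟨d, hd, hd'⟩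
    refine ⟨c + d, ?_, ?_⟩
    · convert add_mem hc hd using 1
      module
    · convert add_mem hc' hd' using 1
      module
  smul_mem' := by
    rintro r x ⟨c, hc, hc'⟩
    rcases le_total 0 r with hr | hr
    · refine ⟨r * c, ?_, ?_⟩
      · convert PointedCone.smul_mem P hr hc using 1
        module
      · convert PointedCone.smul_mem P hr hc' using 1
        module
    · refine ⟨-r * c, ?_, ?_⟩
      · convert PointedCone.smul_mem P (neg_nonneg.2 hr) hc' using 1
        module
      · convert PointedCone.smul_mem P (neg_nonneg.2 hr) hc using 1
        module

lemma mem_boundedElements {v : V} :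
    v ∈ boundedElements P u ↔ ∃ c : ℚ, c • u - v ∈ P ∧ c • u + v ∈ P := Iff.rfl

/-- This is what maximality buys. The least integer upper bound `k` of `w` exists by boundedness,
and since `w ≥ k` can be adjoined, it already holds. -/
lemma IsCuttingCone.exists_int_of_maximal (h : Maximal (IsCuttingCone L u) P) (hu : u ∈ L) {w : V}
    (hw : w ∈ L) (hb : w ∈ boundedElements P u) :
    ∃ k : ℤ, (k : ℚ) • u - w ∈ P ∧ w - (k : ℚ) • u ∈ P := by
  obtain ⟨c, hc, hc'⟩ := hb
  have hP := h.prop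
  obtain ⟨k, hk, hmin⟩ := Int.exists_least_of_bdd (P := fun k : ℤ => (k : ℚ) • u - w ∈ P)
    ⟨-⌈c⌉, fun k hk => by
      have h1 : (c + k) • u ∈ P := by
        convert add_mem hc' hk using 1
        module
      have h2 := hP.nonneg_of_smul_mem h1
      have h3 : ((-⌈c⌉ : ℤ) : ℚ) ≤ k := by
        push_cast
        linarith [Int.le_ceil c]
      exact_mod_cast h3⟩
    ⟨⌈c⌉, by
      convert add_mem hc (PointedCone.smul_mem P (sub_nonneg.2 (Int.le_ceil c)) hP.unit_mem) using 1
      module⟩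
  refine ⟨k, hk, ?_⟩
  have hadj := hP.adjoinNeg hu hw hk fun hlt => by
    have := hmin _ hlt
    omega
  refine h.le_of_ge hadj (fun x hx => ⟨0, le_rfl, by simpa using hx⟩) ⟨1, zero_le_one, ?_⟩
  simp

/-- The bounded elements form a face of the cone, so the image of `P` in the quotient by them
contains no line, as Gordan's theorem requires. -/
lemma mem_boundedElements_of_add {s p : V} (hs : s ∈ P) (hp : p ∈ P)
    (h : p + s ∈ boundedElements P u) : s ∈ boundedElements P u := by
  obtain ⟨c, hc, hc'⟩ := h
  have h2 : c • u ∈ P := by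
    convert PointedCone.smul_mem P (r := 1 / 2) (by norm_num) (add_mem hc hc') using 1
    module
  refine ⟨c, ?_, add_mem h2 hs⟩
  convert add_mem hc hp using 1
  module

end Cones

/-! ### Rational functionals realizing finitely many sign and integrality conditions -/

section Functionals

variable {V : Type*} [AddCommGroup V] [Module ℚ V]

/-- Modulo a subspace `B`, a finite set generates a free group, so that it has a `ℚ`-linear lift
which maps this group into the group generated by the given representatives. -/
lemma exists_linear_section (B : Submodule ℚ V) (T : Set V) (hT : T.Finite) :
    ∃ ρ : (V ⧸ B) →ₗ[ℚ] V, (∀ x, B.mkQ (ρ x) = x) ∧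
      ∀ t ∈ T, ρ (B.mkQ t) ∈ Submodule.span ℤ T := by
  let π : V →ₗ[ℤ] V ⧸ B := B.mkQ.restrictScalars ℤ
  let M : Submodule ℤ (V ⧸ B) := (Submodule.span ℤ T).map π
  have : Module.Finite ℤ M := Module.Finite.iff_fg.2 ((Submodule.fg_span hT).map π)
  have : Module.IsTorsionFree ℤ (V ⧸ B) := .trans ℚ
  let e := Module.Free.chooseBasis ℤ M
  have hlift : ∀ i, ∃ f ∈ Submodule.span ℤ T, π f = (e i : V ⧸ B) := fun i =>
    Submodule.mem_map.1 (e i).2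
  choose f hf hπf using hlift
  -- `M` is finitely generated and torsion-free over `ℤ`, hence free; clearing denominators keeps
  -- its basis independent over `ℚ`.
  have hli : LinearIndependent ℚ fun i => (e i : V ⧸ B) := by
    rw [← LinearIndependent.iff_fractionRing ℤ ℚ]
    exact e.linearIndependent.map' M.subtype (Submodule.ker_subtype M)
  obtain ⟨ρ₀, hρ₀⟩ := LinearMap.exists_rightInverse_of_surjective B.mkQ (Submodule.range_mkQ B)
  have hρ₀' : ∀ x, B.mkQ (ρ₀ x) = x := fun x => LinearMap.congr_fun hρ₀ x
  have hB : ∀ i, f i - ρ₀ (e i) ∈ B := fun i => by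
    rw [← Submodule.Quotient.mk_eq_zero, ← Submodule.mkQ_apply, map_sub, hρ₀', sub_eq_zero]
    exact hπf i
  -- An arbitrary section `ρ₀` is corrected by a `B`-valued map so that it takes the chosen value `f
  -- i` at each basis element.
  obtain ⟨g, hg⟩ := LinearMap.exists_extend
    ((Module.Basis.span hli).constr ℚ fun i => (⟨f i - ρ₀ (e i), hB i⟩ : B))
  have hge : ∀ i, (g (e i) : V) = f i - ρ₀ (e i) := fun i => by
    have h1 := LinearMap.congr_fun hg (Module.Basis.span hli i)
    rw [Module.Basis.constr_basis, LinearMap.comp_apply, Submodule.subtype_apply,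
      Module.Basis.span_apply] at h1
    rw [h1]
  let ρ : (V ⧸ B) →ₗ[ℚ] V := ρ₀ + B.subtype ∘ₗ g
  have hρe : ∀ i, ρ (e i) = f i := fun i => by simp [ρ, hge]
  refine ⟨ρ, fun x => ?_, fun t ht => ?_⟩
  · have : B.mkQ (g x : V) = 0 := (Submodule.Quotient.mk_eq_zero B).2 (g x).2
    simp only [ρ, LinearMap.add_apply, LinearMap.comp_apply, Submodule.subtype_apply, map_add,
      this, add_zero, hρ₀']
  · have hM : ∀ y : M, ρ y ∈ Submodule.span ℤ T := fun y => by
      have h1 : ((ρ.restrictScalars ℤ) ∘ₗ M.subtype) y =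
          ((ρ.restrictScalars ℤ) ∘ₗ M.subtype) (∑ i, e.repr y i • e i) := by rw [e.sum_repr]
      rw [map_sum] at h1
      change ρ y = _ at h1
      rw [h1]
      refine sum_mem fun i _ => ?_
      rw [map_smul]
      refine Submodule.smul_mem _ _ ?_
      change ρ (e i) ∈ _
      rw [hρe]
      exact hf i
    exact hM ⟨π t, Submodule.mem_map_of_mem (Submodule.subset_span ht)⟩

variable {L : AddSubgroup V} {u : V} {P : PointedCone ℚ V}

/-- A functional that is positive on those elements of a finite part of the cone that are not
bounded, vanishes on the bounded elements, and is integral at given elements. -/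
lemma exists_pos_of_not_bounded (S T : Finset V) (hS : ∀ s ∈ S, s ∈ P) :
    ∃ ψ : (V ⧸ boundedElements P u) →ₗ[ℚ] ℚ,
      (∀ s ∈ S, s ∉ boundedElements P u → 0 < ψ (Submodule.mkQ _ s)) ∧
        ∀ t ∈ T, ∃ k : ℤ, ψ (Submodule.mkQ _ t) = k := by
  classical
  set B := boundedElements P u with hBdef
  obtain ⟨ψ, hψ⟩ := exists_linearMap_pos ((S.filter (· ∉ B)).image B.mkQ) fun x hx hneg => by
    obtain ⟨s, hs, rfl⟩ := Finset.mem_image.1 hx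
    obtain ⟨hsS, hsB⟩ := Finset.mem_filter.1 hs
    have hle : PointedCone.hull ℚ (((S.filter (· ∉ B)).image B.mkQ : Finset _) : Set (V ⧸ B)) ≤
        PointedCone.map B.mkQ P := by
      refine Submodule.span_le.2 fun y hy => ?_
      obtain ⟨s', hs', rfl⟩ := Finset.mem_image.1 (Finset.mem_coe.1 hy)
      exact PointedCone.mem_map.2 ⟨s', hS _ (Finset.mem_filter.1 hs').1, rfl⟩
    obtain ⟨p, hp, hpe⟩ := PointedCone.mem_map.1 (hle hneg)
    refine hsB (mem_boundedElements_of_add (hS s hsS) hp ?_)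
    rw [← hBdef, ← Submodule.Quotient.mk_eq_zero, ← Submodule.mkQ_apply, map_add, hpe,
      neg_add_cancel]
  obtain ⟨b, hb⟩ := IsLocalization.exist_integer_multiples_of_finset (nonZeroDivisors ℤ)
    (T.image fun t => ψ (B.mkQ t))
  have hb0 : (b : ℤ) ≠ 0 := nonZeroDivisors.coe_ne_zero b
  -- The common denominator `b` may be negative; its square clears denominators and keeps signs.
  refine ⟨((b : ℤ) ^ 2 : ℚ) • ψ, fun s hs hsB => ?_, fun t ht => ?_⟩
  · have := hψ _ (Finset.mem_image_of_mem B.mkQ (Finset.mem_filter.2 ⟨hs, hsB⟩))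
    rw [LinearMap.smul_apply, smul_eq_mul]
    positivity
  · obtain ⟨k, hk⟩ := hb _ (Finset.mem_image_of_mem _ ht)
    refine ⟨b * k, ?_⟩
    rw [LinearMap.smul_apply, smul_eq_mul]
    rw [eq_intCast, Algebra.smul_def, eq_intCast] at hk
    push_cast
    rw [hk]
    ring

/-- Finitely many sign and integrality conditions that hold for a cutting cone are realized by a
rational functional. -/
theorem IsCuttingCone.exists_linearMap (h : IsCuttingCone L u P) (hu : u ∈ L) (S T : Finset V)
    (hS : ∀ s ∈ S, s ∈ P) (hT : ∀ t ∈ T, t ∈ L) :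
    ∃ φ : V →ₗ[ℚ] ℚ, φ u = 1 ∧ (∀ s ∈ S, 0 ≤ φ s) ∧ ∀ t ∈ T, ∃ k : ℤ, φ t = k := by
  classical
  obtain ⟨Q, hPQ, hQ⟩ := h.exists_maximal
  have hS : ∀ s ∈ S, s ∈ Q := fun s hs => hPQ (hS s hs)
  have hcut := hQ.prop
  obtain ⟨ψ, hψS, hψT⟩ := exists_pos_of_not_bounded S T hS
  let B := boundedElements Q u
  have huB : u ∈ B := mem_boundedElements.2 ⟨1, by simp, by
    convert Q.smul_mem (r := 2) (by norm_num) hcut.unit_mem using 1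
    module⟩
  obtain ⟨ρ, hρ, hρT⟩ := exists_linear_section B (T : Set V) T.finite_toSet
  have hint : ∀ t ∈ T, ∃ k : ℤ, (k : ℚ) • u - (t - ρ (B.mkQ t)) ∈ Q ∧
      (t - ρ (B.mkQ t)) - (k : ℚ) • u ∈ Q := fun t ht => by
    refine IsCuttingCone.exists_int_of_maximal hQ hu ?_ ?_
    · have hle : Submodule.span ℤ (T : Set V) ≤ AddSubgroup.toIntSubmodule L :=
        Submodule.span_le.2 hT
      exact sub_mem (hT t ht) (hle (hρT t ht))
    · change _ ∈ B
      rw [← Submodule.Quotient.mk_eq_zero, ← Submodule.mkQ_apply, map_sub, hρ, sub_self]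
  choose! k hk hk' using hint
  -- Both inequalities are included, so that a normalized functional nonnegative on `R` takes the
  -- value `k t` at `t - ρ (B.mkQ t)`.
  let R : Finset V := S ∪ T.image (fun t => (k t : ℚ) • u - (t - ρ (B.mkQ t))) ∪
    T.image (fun t => (t - ρ (B.mkQ t)) - (k t : ℚ) • u)
  have hR : ∀ x ∈ R, x ∈ Q := by
    intro x hx
    simp only [R, Finset.mem_union, Finset.mem_image] at hx
    rcases hx with (hx | ⟨t, ht, rfl⟩) | ⟨t, ht, rfl⟩
    exacts [hS x hx, hk t ht, hk' t ht]
  obtain ⟨φ₀, hφ₀, hφu⟩ := exists_linearMap_of_notMem_hull R id (-u) fun hmem =>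
    hcut.neg_unit_notMem <| (Submodule.span_le (p := Q)).2 (fun x hx => hR x (by simpa using hx)) hmem
  replace hφu : 0 < φ₀ u := by simpa using hφu
  let φ : V →ₗ[ℚ] ℚ := (φ₀ u)⁻¹ • φ₀
  have hφu1 : φ u = 1 := by simp [φ, hφu.ne']
  have hφR : ∀ x ∈ R, 0 ≤ φ x := fun x hx =>
    mul_nonneg (inv_nonneg.2 hφu.le) (hφ₀ x hx)
  have hφT : ∀ t ∈ T, φ (t - ρ (B.mkQ t)) = k t := fun t ht => by
    have h1 := hφR ((k t : ℚ) • u - (t - ρ (B.mkQ t))) (by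
      simp only [R, Finset.mem_union, Finset.mem_image]
      exact Or.inl (Or.inr ⟨t, ht, rfl⟩))
    have h2 := hφR ((t - ρ (B.mkQ t)) - (k t : ℚ) • u) (by
      simp only [R, Finset.mem_union, Finset.mem_image]
      exact Or.inr ⟨t, ht, rfl⟩)
    rw [map_sub, map_smul, hφu1, smul_eq_mul, mul_one] at h1 h2
    linarith
  have hmk : ∀ v ∈ B, B.mkQ v = 0 := fun v hv => (Submodule.Quotient.mk_eq_zero B).2 hv
  -- On `B` this is `φ` for every `N`. At an unbounded `s` the `ψ` term dominates for large `N`, and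
  -- an integer `N` keeps the values on `T` integral.
  let Φ : ℕ → V →ₗ[ℚ] ℚ := fun N =>
    φ ∘ₗ (LinearMap.id - ρ ∘ₗ B.mkQ) + (N : ℚ) • (ψ ∘ₗ B.mkQ)
  have hΦ : ∀ N v, Φ N v = φ (v - ρ (B.mkQ v)) + N * ψ (B.mkQ v) := fun N v => by
    simp [Φ]
  have hev : ∀ᶠ N : ℕ in Filter.atTop, ∀ s ∈ S, 0 ≤ Φ N s := by
    rw [Filter.eventually_all_finset]
    intro s hs
    by_cases hsB : s ∈ B
    · refine Filter.Eventually.of_forall fun N => ?_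
      rw [hΦ, hmk s hsB]
      simpa using hφR s (by simp [R, hs])
    · have hpos : 0 < ψ (B.mkQ s) := hψS s hs hsB
      obtain ⟨N₀, hN₀⟩ := exists_nat_ge (-φ (s - ρ (B.mkQ s)) / ψ (B.mkQ s))
      filter_upwards [Filter.eventually_ge_atTop N₀] with N hN
      rw [hΦ]
      have h1 : -φ (s - ρ (B.mkQ s)) / ψ (B.mkQ s) ≤ N := hN₀.trans (by exact_mod_cast hN)
      rw [div_le_iff₀ hpos] at h1
      linarith
  obtain ⟨N, hN⟩ := hev.exists
  refine ⟨Φ N, ?_, hN, fun t ht => ?_⟩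
  · rw [hΦ, hmk u huB]
    simpa using hφu1
  · obtain ⟨j, hj⟩ := hψT t ht
    refine ⟨k t + N * j, ?_⟩
    replace hj : ψ (B.mkQ t) = j := hj
    rw [hΦ, hφT t ht, hj]
    push_cast
    ring

end Functionals

/-! ### Structures for the signature and their axioms -/

section Models

/-- The operations and relations on `M` are those of its `sig`-structure. -/
structure Compatible (M : Type*) [sig.Structure M] [Zero M] [One M] [Add M] [Mul M] [LE M]
    (I : M → Prop) : Prop where
  funMap_zero : ∀ v : Fin 0 → M, Structure.funMap zeroSym v = 0
  funMap_one : ∀ v : Fin 0 → M, Structure.funMap oneSym v = 1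
  funMap_add : ∀ v : Fin 2 → M, Structure.funMap addSym v = v 0 + v 1
  funMap_mul : ∀ v : Fin 2 → M, Structure.funMap mulSym v = v 0 * v 1
  relMap_le : ∀ v : Fin 2 → M, Structure.RelMap leSym v ↔ v 0 ≤ v 1
  relMap_int : ∀ v : Fin 1 → M, Structure.RelMap intSym v ↔ I (v 0)

namespace Compatible

variable {M : Type*} [sig.Structure M] {α : Type*} {n : ℕ}

section Raw

variable [Zero M] [One M] [Add M] [Mul M] [LE M] {I : M → Prop}

lemma realize_zero (h : Compatible M I) (v : α → M) : (0 : sig.Term α).realize v = 0 :=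
  h.funMap_zero _

lemma realize_one (h : Compatible M I) (v : α → M) : (1 : sig.Term α).realize v = 1 :=
  h.funMap_one _

lemma realize_add (h : Compatible M I) (v : α → M) (s t : sig.Term α) :
    (s + t).realize v = s.realize v + t.realize v :=
  h.funMap_add _

lemma realize_mul (h : Compatible M I) (v : α → M) (s t : sig.Term α) :
    (s * t).realize v = s.realize v * t.realize v :=
  h.funMap_mul _

lemma realize_leF (h : Compatible M I) (v : α → M) (xs : Fin n → M)
    (s t : sig.Term (α ⊕ Fin n)) :
    (leF s t).Realize v xs ↔ s.realize (Sum.elim v xs) ≤ t.realize (Sum.elim v xs) :=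
  h.relMap_le _

lemma realize_intF (h : Compatible M I) (v : α → M) (xs : Fin n → M) (t : sig.Term (α ⊕ Fin n)) :
    (intF t).Realize v xs ↔ I (t.realize (Sum.elim v xs)) :=
  h.relMap_int _

lemma models_commRingAxioms_iff (h : Compatible M I) :
    M ⊨ commRingAxioms ↔ (∀ a b c : M, a + (b + c) = a + b + c) ∧
      (∀ a b c : M, a * (b * c) = a * b * c) ∧ (∀ a b : M, a + b = b + a) ∧
      (∀ a b : M, a * b = b * a) ∧ (∀ a : M, a + 0 = a) ∧ (∀ a : M, a * 1 = a) ∧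
      (∀ a b c : M, a * (b + c) = a * b + a * c) ∧ ∀ a : M, ∃ b, a + b = 0 := by
  simp [commRingAxioms, Theory.model_iff, Sentence.Realize, Formula.Realize, h.realize_zero,
    h.realize_one, h.realize_add, h.realize_mul, Fin.snoc]

lemma models_orderAxioms_iff (h : Compatible M I) :
    M ⊨ orderAxioms ↔ (∀ a : M, a ≤ a) ∧ (∀ a b c : M, a ≤ b → b ≤ c → a ≤ c) ∧
      (∀ a b : M, a ≤ b → b ≤ a → a = b) ∧ (∀ a b c : M, a ≤ b → a + c ≤ b + c) ∧
      (0 : M) ≤ 1 ∧ (0 : M) ≠ 1 := by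
  simp [orderAxioms, Theory.model_iff, Sentence.Realize, Formula.Realize, h.realize_zero,
    h.realize_one, h.realize_add, h.realize_leF, Fin.snoc]

lemma models_intAxioms_iff (h : Compatible M I) :
    M ⊨ intAxioms ↔ I 1 ∧ (∀ a b : M, I a → I b → I (a + b)) ∧
      ∀ a b : M, I a → a + b = 0 → I b := by
  simp [intAxioms, Theory.model_iff, Sentence.Realize, Formula.Realize, h.realize_zero,
    h.realize_one, h.realize_add, h.realize_intF, Fin.snoc]

end Raw

section Ring

variable [CommRing M] [LE M] {I : M → Prop}

lemma realize_nsum (h : Compatible M I) (v : α → M) (k : ℕ) (t : sig.Term α) :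
    (nsum k t).realize v = k • t.realize v := by
  induction k with
  | zero => simp [nsum, h.realize_zero]
  | succ k ih => simp only [nsum, h.realize_add, ih, succ_nsmul]

lemma models_divisibility_iff (h : Compatible M I) (k : ℕ) :
    M ⊨ divisibility k ↔ ∃ x : M, k • x = 1 := by
  simp [divisibility, Sentence.Realize, Formula.Realize, h.realize_one, h.realize_nsum, Fin.snoc]

lemma models_perforationFree_iff (h : Compatible M I) (k : ℕ) :
    M ⊨ perforationFree k ↔ ∀ x : M, 0 ≤ k • x → 0 ≤ x := by
  simp [perforationFree, Sentence.Realize, Formula.Realize, h.realize_zero, h.realize_leF,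
    h.realize_nsum, Fin.snoc]

lemma models_cuttingPlane_iff (h : Compatible M I) (k : ℕ) (m : ℤ) :
    M ⊨ cuttingPlane k m ↔ ∀ x : M, I x →
      ((-m).toNat • (1 : M) ≤ k • x + m.toNat • (1 : M)) →
        (-⌊(m : ℚ) / k⌋).toNat • (1 : M) ≤ x + ⌊(m : ℚ) / k⌋.toNat • (1 : M) := by
  simp [cuttingPlane, nonnegAddConst, Sentence.Realize, Formula.Realize, h.realize_one,
    h.realize_add, h.realize_intF, h.realize_leF, h.realize_nsum, Fin.snoc]

end Ring

end Compatible

/-- The order and integrality axioms of linear integer/real rings, for a commutative ring. -/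
structure IsLinearIntegerRealRing (M : Type*) [CommRing M] [LE M] (I : M → Prop) : Prop where
  le_refl : ∀ a : M, a ≤ a
  le_trans : ∀ a b c : M, a ≤ b → b ≤ c → a ≤ c
  le_antisymm : ∀ a b : M, a ≤ b → b ≤ a → a = b
  add_le_add_right : ∀ a b c : M, a ≤ b → a + c ≤ b + c
  zero_le_one : (0 : M) ≤ 1
  zero_ne_one : (0 : M) ≠ 1
  exists_nsmul_eq_one : ∀ n : ℕ, 1 ≤ n → ∃ x : M, n • x = 1
  nonneg_of_nsmul : ∀ n : ℕ, 1 ≤ n → ∀ x : M, 0 ≤ n • x → 0 ≤ x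
  int_one : I 1
  int_add : ∀ a b : M, I a → I b → I (a + b)
  int_neg : ∀ a b : M, I a → a + b = 0 → I b
  cuttingPlane : ∀ (n : ℕ) (m : ℤ), 1 ≤ n → ∀ x : M, I x →
    ((-m).toNat • (1 : M) ≤ n • x + m.toNat • (1 : M)) →
      (-⌊(m : ℚ) / n⌋).toNat • (1 : M) ≤ x + ⌊(m : ℚ) / n⌋.toNat • (1 : M)

lemma Compatible.models_LIRR_iff {M : Type*} [sig.Structure M] [CommRing M] [LE M] {I : M → Prop}
    (h : Compatible M I) : M ⊨ LIRR ↔ IsLinearIntegerRealRing M I := by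
  have h1 : M ⊨ commRingAxioms := h.models_commRingAxioms_iff.2
    ⟨fun a b c => (add_assoc a b c).symm, fun a b c => (mul_assoc a b c).symm, add_comm, mul_comm,
      add_zero, mul_one, mul_add, fun a => ⟨-a, add_neg_cancel a⟩⟩
  have h2 : M ⊨ LIRR ↔ M ⊨ orderAxioms ∧ (∀ n : ℕ, 1 ≤ n → M ⊨ divisibility n) ∧
      (∀ n : ℕ, 1 ≤ n → M ⊨ perforationFree n) ∧ M ⊨ intAxioms ∧
      ∀ (n : ℕ) (m : ℤ), 1 ≤ n → M ⊨ LIRing.cuttingPlane n m := by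
    simp only [Theory.model_iff] at h1 ⊢
    simp only [LIRR, LRR, Set.mem_union, Set.mem_ofPred_eq]
    constructor
    · exact fun H => ⟨fun φ hφ => H φ (by tauto),
        fun n hn => H _ (Or.inl (Or.inl (Or.inl (Or.inr ⟨n, hn, rfl⟩)))),
        fun n hn => H _ (Or.inl (Or.inl (Or.inr ⟨n, hn, rfl⟩))), fun φ hφ => H φ (by tauto),
        fun n m hn => H _ (Or.inr ⟨n, m, hn, rfl⟩)⟩
    · rintro ⟨ho, hd, hp, hi, hc⟩ φ
        (((((hφ | hφ) | ⟨n, hn, rfl⟩) | ⟨n, hn, rfl⟩) | hφ) | ⟨n, m, hn, rfl⟩)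
      exacts [h1 φ hφ, ho φ hφ, hd n hn, hp n hn, hi φ hφ, hc n m hn]
  rw [h2, h.models_orderAxioms_iff, h.models_intAxioms_iff]
  simp only [h.models_divisibility_iff, h.models_perforationFree_iff, h.models_cuttingPlane_iff]
  constructor
  · rintro ⟨⟨o1, o2, o3, o4, o5, o6⟩, d, p, ⟨i1, i2, i3⟩, c⟩
    exact ⟨o1, o2, o3, o4, o5, o6, d, p, i1, i2, i3, c⟩
  · rintro ⟨o1, o2, o3, o4, o5, o6, d, p, i1, i2, i3, c⟩
    exact ⟨⟨o1, o2, o3, o4, o5, o6⟩, d, p, ⟨i1, i2, i3⟩, c⟩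

/-- A model of the ring axioms is a commutative ring. -/
lemma exists_compatible_commRing (M : Type*) [sig.Structure M] (hM : M ⊨ commRingAxioms) :
    ∃ (_ : CommRing M) (_ : LE M) (I : M → Prop), Compatible M I := by
  let : Zero M := ⟨Structure.funMap zeroSym default⟩
  let : One M := ⟨Structure.funMap oneSym default⟩
  let : Add M := ⟨fun a b => Structure.funMap addSym ![a, b]⟩
  let : Mul M := ⟨fun a b => Structure.funMap mulSym ![a, b]⟩
  let : LE M := ⟨fun a b => Structure.RelMap leSym ![a, b]⟩
  let I : M → Prop := fun a => Structure.RelMap intSym ![a]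
  have h2 : ∀ v : Fin 2 → M, ![v 0, v 1] = v := fun v => by
    ext i
    fin_cases i <;> rfl
  have hc : Compatible M I :=
    ⟨fun v => congrArg _ (Subsingleton.elim _ _), fun v => congrArg _ (Subsingleton.elim _ _),
      fun v => congrArg _ (h2 v).symm, fun v => congrArg _ (h2 v).symm,
      fun v => iff_of_eq (congrArg _ (h2 v).symm), fun v => iff_of_eq (congrArg _ (by
        ext i
        fin_cases i
        rfl))⟩
  obtain ⟨r1, r2, r3, r4, r5, r6, r7, r8⟩ := hc.models_commRingAxioms_iff.1 hM
  choose neg hneg using r8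
  have hz : ∀ a : M, 0 * a = 0 := fun a => by
    have e1 : a * 0 + a * 0 = a * 0 := by rw [← r7, r5]
    have e2 := congrArg (· + neg (a * 0)) e1
    simp only [← r1, hneg, r5] at e2
    rw [r4, e2]
  let : Neg M := ⟨neg⟩
  let : CommRing M :=
    { add_assoc := fun a b c => (r1 a b c).symm
      zero_add := fun a => by rw [r3, r5]
      add_zero := r5
      add_comm := r3
      mul_assoc := fun a b c => (r2 a b c).symm
      one_mul := fun a => by rw [r4, r6]
      mul_one := r6
      mul_comm := r4
      left_distrib := r7
      right_distrib := fun a b c => by rw [r4, r7, r4 c a, r4 c b]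
      zero_mul := hz
      mul_zero := fun a => by rw [r4, hz]
      neg_add_cancel := fun a => by rw [r3]; exact hneg a
      nsmul := nsmulRec
      zsmul := zsmulRec }
  exact ⟨inferInstance, inferInstance, I, hc⟩

lemma compatible_real : Compatible ℝ fun x => ∃ k : ℤ, (k : ℝ) = x :=
  ⟨fun _ => rfl, fun _ => rfl, fun _ => rfl, fun _ => rfl, fun _ => Iff.rfl, fun _ => Iff.rfl⟩

/-- Undoes the subtraction-free encoding of `nonnegAddConst`, through `m = m⁺ - m⁻`. -/
lemma toNat_neg_smul_le_iff (x : ℝ) (m : ℤ) :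
    (-m).toNat • (1 : ℝ) ≤ x + m.toNat • (1 : ℝ) ↔ 0 ≤ x + m := by
  have : (m : ℝ) = (m.toNat : ℝ) - ((-m).toNat : ℝ) := by
    exact_mod_cast (Int.toNat_sub_toNat_neg m).symm
  rw [this]
  simp only [nsmul_eq_mul, mul_one]
  constructor <;> intro h <;> linarith

lemma real_models_LIRR : ℝ ⊨ LIRR := by
  refine compatible_real.models_LIRR_iff.2
    ⟨le_refl, fun _ _ _ => le_trans, fun _ _ => le_antisymm, fun _ _ c h => by linarith, zero_le_one,
      zero_ne_one, fun n hn => ⟨(n : ℝ)⁻¹, ?_⟩, fun n hn x hx => ?_, ⟨1, by simp⟩, ?_, ?_, ?_⟩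
  · rw [nsmul_eq_mul, mul_inv_cancel₀ (by positivity)]
  · rw [nsmul_eq_mul] at hx
    exact nonneg_of_mul_nonneg_right hx (by positivity)
  · rintro _ _ ⟨a, rfl⟩ ⟨b, rfl⟩
    exact ⟨a + b, by simp⟩
  · rintro _ b ⟨a, rfl⟩ hab
    exact ⟨-a, by push_cast; linarith⟩
  · rintro n m hn _ ⟨k, rfl⟩ hk
    rw [toNat_neg_smul_le_iff] at hk ⊢
    rw [nsmul_eq_mul] at hk
    have hk' : (0 : ℚ) ≤ n * k + m := by exact_mod_cast hk
    have hn' : (0 : ℚ) < n := by exact_mod_cast hn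
    -- The integer `-k` is at most `m / n`, hence at most its floor.
    have : -k ≤ ⌊(m : ℚ) / n⌋ := by
      rw [Int.le_floor, le_div_iff₀ hn']
      push_cast
      linarith
    exact_mod_cast (by linarith : 0 ≤ k + ⌊(m : ℚ) / n⌋)

end Models

/-! ### From models of `LIRR` to cutting cones, and transfer of formulas along functionals -/

section Evaluation

namespace IsLinearIntegerRealRing

variable {M : Type*} [CommRing M] [LE M] {I : M → Prop}

/-- If a positive integer `n` vanished in `M ⧸ J`, then `1 = n x` would lie in `J`; so every proper
quotient has characteristic zero. -/
lemma nonempty_algebraRat (h : IsLinearIntegerRealRing M I) : Nonempty (Algebra ℚ M) := by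
  refine (EqualCharZero.nonempty_algebraRat_iff M).2 fun J hJ => charZero_of_inj_zero fun n hn => ?_
  by_contra hn0
  obtain ⟨x, hx⟩ := h.exists_nsmul_eq_one n (Nat.one_le_iff_ne_zero.2 hn0)
  refine hJ ((Ideal.eq_top_iff_one J).2 ?_)
  rw [← map_natCast (Ideal.Quotient.mk J), Ideal.Quotient.eq_zero_iff_mem] at hn
  rw [← hx, nsmul_eq_mul]
  exact J.mul_mem_right _ hn

lemma le_iff_sub_nonneg (h : IsLinearIntegerRealRing M I) (a b : M) : a ≤ b ↔ 0 ≤ b - a := by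
  constructor
  · intro hab
    simpa [sub_eq_add_neg] using h.add_le_add_right _ _ (-a) hab
  · intro hab
    simpa using h.add_le_add_right _ _ a hab

lemma add_nonneg (h : IsLinearIntegerRealRing M I) {a b : M} (ha : 0 ≤ a) (hb : 0 ≤ b) :
    0 ≤ a + b := by
  have := h.add_le_add_right _ _ b ha
  rw [zero_add] at this
  exact h.le_trans _ _ _ hb this

lemma nsmul_nonneg (h : IsLinearIntegerRealRing M I) {a : M} (ha : 0 ≤ a) (n : ℕ) :
    0 ≤ n • a := by
  induction n with
  | zero => simpa using h.le_refl 0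
  | succ n ih => rw [succ_nsmul]; exact h.add_nonneg ih ha

lemma toNat_neg_smul_le_iff (h : IsLinearIntegerRealRing M I) (x : M) (m : ℤ) :
    (-m).toNat • (1 : M) ≤ x + m.toNat • (1 : M) ↔ 0 ≤ x + m := by
  have : (m : M) = (m.toNat : M) - ((-m).toNat : M) := by
    have := congrArg (Int.cast : ℤ → M) (Int.toNat_sub_toNat_neg m).symm
    simpa only [Int.cast_sub, Int.cast_natCast] using this
  rw [h.le_iff_sub_nonneg, this]
  simp only [nsmul_eq_mul, mul_one, add_sub_assoc]

variable [Algebra ℚ M]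

/-- The nonnegative elements. -/
def nonnegCone (h : IsLinearIntegerRealRing M I) : PointedCone ℚ M where
  carrier := {x | 0 ≤ x}
  zero_mem' := h.le_refl 0
  add_mem' := h.add_nonneg
  smul_mem' := by
    rintro ⟨r, hr⟩ x hx
    change 0 ≤ r • x
    -- Perforation-freeness allows clearing the denominator, leaving a natural multiple of `x`.
    refine h.nonneg_of_nsmul r.den r.den_pos _ ?_
    have : r.den • r • x = r.num.toNat • x := by
      rw [← Nat.cast_smul_eq_nsmul ℚ, ← Nat.cast_smul_eq_nsmul ℚ, smul_smul, Rat.den_mul_eq_num]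
      congr 1
      exact_mod_cast (Int.toNat_of_nonneg (Rat.num_nonneg.2 hr)).symm
    rw [this]
    exact h.nsmul_nonneg hx _

/-- The integral elements. -/
def intSubgroup (h : IsLinearIntegerRealRing M I) : AddSubgroup M where
  carrier := {x | I x}
  zero_mem' := by
    have := h.int_add _ _ h.int_one (h.int_neg _ (-1) h.int_one (add_neg_cancel 1))
    rwa [add_neg_cancel] at this
  add_mem' := h.int_add _ _
  neg_mem' {a} ha := h.int_neg a _ ha (add_neg_cancel a)

/-- Rounding at `q` is the cutting plane axiom with `n = q.den` and `m = q.num`, after multiplying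
by the denominator. -/
lemma isCuttingCone (h : IsLinearIntegerRealRing M I) :
    IsCuttingCone h.intSubgroup (1 : M) h.nonnegCone where
  unit_mem := h.zero_le_one
  neg_unit_notMem hneg := by
    have := h.add_le_add_right _ _ 1 (show (0 : M) ≤ -1 from hneg)
    rw [zero_add, neg_add_cancel] at this
    exact h.zero_ne_one (h.le_antisymm _ _ h.zero_le_one this)
  round w hw q hq := by
    have h1 : (0 : M) ≤ q.den • (w + q • (1 : M)) := h.nsmul_nonneg hq _
    have h2 : q.den • (w + q • (1 : M)) = q.den • w + (q.num : M) := by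
      rw [nsmul_add, ← Nat.cast_smul_eq_nsmul ℚ q.den (q • (1 : M)), smul_smul,
        Rat.den_mul_eq_num, Int.cast_smul_eq_zsmul, zsmul_one]
    rw [h2, ← h.toNat_neg_smul_le_iff] at h1
    have h3 := h.cuttingPlane q.den q.num q.den_pos w hw h1
    rw [h.toNat_neg_smul_le_iff, Rat.num_div_den] at h3
    change (0 : M) ≤ w + (⌊q⌋ : ℚ) • (1 : M)
    rwa [Int.cast_smul_eq_zsmul, zsmul_one]

end IsLinearIntegerRealRing

variable {X : Type u} {M : Type*} [sig.Structure M] [(sig[[X]]).Structure M]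
  [(sig.lhomWithConstants X).IsExpansionOn M] [CommRing M] [LE M] {I : M → Prop}

/-- The valuation of the constants in `ℝ` obtained by applying a map to their values in `M`. -/
def imageValuation (X : Type u) {M : Type*} [(sig[[X]]).Structure M] (φ : M → ℚ) : X → ℝ :=
  fun x => (φ (sig.con x : M) : ℝ)

variable [Module ℚ M]

/-- Linearity and `φ 1 = 1` suffice only because `·` is excluded: `φ` need not be multiplicative. -/
lemma TermMulFree.realize_imageValuation (hc : Compatible M I) (φ : M →ₗ[ℚ] ℚ) (hφ : φ 1 = 1)
    {α : Type*} {t : (sig[[X]]).Term α} (ht : TermMulFree t) (v : α → M) :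
    letI := constantsOn.structure (imageValuation X φ)
    t.realize (fun a => (φ (v a) : ℝ)) = (φ (t.realize v) : ℝ) := by
  let := constantsOn.structure (imageValuation X φ)
  induction ht with
  | var a => rfl
  | const x =>
    rw [Term.realize_constants, Term.realize_constants]
    rfl
  | zero =>
    have h1 : (Constants.term ((sig.lhomWithConstants X).onFunction zeroSym)).realize v = 0 :=
      (LHom.map_onFunction (sig.lhomWithConstants X) zeroSym _).trans (hc.funMap_zero _)
    rw [h1, map_zero, Rat.cast_zero]
    rfl
  | one =>
    have h1 : (Constants.term ((sig.lhomWithConstants X).onFunction oneSym)).realize v = 1 :=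
      (LHom.map_onFunction (sig.lhomWithConstants X) oneSym _).trans (hc.funMap_one _)
    rw [h1, hφ, Rat.cast_one]
    rfl
  | @add s t _ _ hs ht =>
    have h1 : (Functions.apply₂ ((sig.lhomWithConstants X).onFunction addSym) s t).realize v =
        s.realize v + t.realize v :=
      (LHom.map_onFunction (sig.lhomWithConstants X) addSym _).trans (hc.funMap_add _)
    rw [h1, map_add, Rat.cast_add, ← hs, ← ht]
    rfl

/-- The truth of a negation- and multiplication-free formula in `M` depends on finitely many sign
and integrality conditions, and functionals that respect these preserve its truth. -/
lemma exists_finset_realize (h : IsLinearIntegerRealRing M I) (hc : Compatible M I) {α : Type*}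
    {n : ℕ} {F : (sig[[X]]).BoundedFormula α n} (hneg : IsQFNegFree F) (hmul : MulFree F)
    (v : α → M) (xs : Fin n → M) (hF : F.Realize v xs) :
    ∃ S T : Finset M, (∀ s ∈ S, 0 ≤ s) ∧ (∀ t ∈ T, I t) ∧
      ∀ φ : M →ₗ[ℚ] ℚ, φ 1 = 1 → (∀ s ∈ S, 0 ≤ φ s) → (∀ t ∈ T, ∃ k : ℤ, φ t = k) →
        letI := constantsOn.structure (imageValuation X φ)
        F.Realize (fun a => (φ (v a) : ℝ)) (fun i => (φ (xs i) : ℝ)) := by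
  classical
  have hsum : ∀ φ : M →ₗ[ℚ] ℚ, Sum.elim (fun a => (φ (v a) : ℝ)) (fun i => (φ (xs i) : ℝ)) =
      fun a => (φ (Sum.elim v xs a) : ℝ) := fun φ => by
    ext (a | a) <;> rfl
  induction hneg with
  | atom ha =>
    cases ha with
    | equal s t =>
      -- An equation is preserved by every map, so it imposes no condition.
      refine ⟨∅, ∅, by simp, by simp, fun φ hφ _ _ => ?_⟩
      let := constantsOn.structure (imageValuation X φ)
      rw [BoundedFormula.realize_bdEqual] at hF ⊢
      rw [hsum, hmul.1.realize_imageValuation hc φ hφ, hmul.2.realize_imageValuation hc φ hφ, hF]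
    | @rel l R ts =>
      have hmul : ∀ i, TermMulFree (ts i) := hmul
      rw [BoundedFormula.realize_rel] at hF
      rcases R with R | R
      · have hF : Structure.RelMap R fun i => (ts i).realize (Sum.elim v xs) :=
          (iff_of_eq ((sig.lhomWithConstants X).map_onRelation R _)).1 hF
        cases R with
        | le =>
          have hle := (hc.relMap_le _).1 hF
          refine ⟨{(ts 1).realize (Sum.elim v xs) - (ts 0).realize (Sum.elim v xs)}, ∅, ?_,
            by simp, fun φ hφ hS _ => ?_⟩
          · simpa using (h.le_iff_sub_nonneg _ _).1 hle
          let := constantsOn.structure (imageValuation X φ)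
          refine BoundedFormula.realize_rel.2 ?_
          have h1 := hS _ (Finset.mem_singleton_self _)
          rw [map_sub, sub_nonneg] at h1
          change ((ts 0).realize (Sum.elim _ _) : ℝ) ≤ (ts 1).realize (Sum.elim _ _)
          rw [hsum, (hmul 0).realize_imageValuation hc φ hφ, (hmul 1).realize_imageValuation hc φ hφ]
          exact_mod_cast h1
        | int =>
          have hint := (hc.relMap_int _).1 hF
          refine ⟨∅, {(ts 0).realize (Sum.elim v xs)}, by simp, by simpa using hint,
            fun φ hφ _ hT => ?_⟩
          let := constantsOn.structure (imageValuation X φ)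
          refine BoundedFormula.realize_rel.2 ?_
          obtain ⟨k, hk⟩ := hT _ (Finset.mem_singleton_self _)
          change ∃ k : ℤ, (k : ℝ) = (ts 0).realize (Sum.elim _ _)
          rw [hsum, (hmul 0).realize_imageValuation hc φ hφ, hk]
          exact ⟨k, by simp⟩
      · exact isEmptyElim R
  | bot => exact hF.elim
  | top => exact ⟨∅, ∅, by simp, by simp, fun φ _ _ _ =>
    let := constantsOn.structure (imageValuation X φ)
    BoundedFormula.realize_top.2 trivial⟩
  | and hφ hψ ih₁ ih₂ =>
    have hF := BoundedFormula.realize_inf.1 hF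
    -- `φ ⊓ ψ` unfolds to `(φ ⟹ ψ ⟹ ⊥) ⟹ ⊥`, whence the shape of the projections of `hmul`.
    obtain ⟨S₁, T₁, hS₁, hT₁, H₁⟩ := ih₁ hmul.1.1 hF.1
    obtain ⟨S₂, T₂, hS₂, hT₂, H₂⟩ := ih₂ hmul.1.2.1 hF.2
    refine ⟨S₁ ∪ S₂, T₁ ∪ T₂, ?_, ?_, fun φ hφ hS hT =>
      let := constantsOn.structure (imageValuation X φ)
      BoundedFormula.realize_inf.2 ⟨?_, ?_⟩⟩
    · simpa only [Finset.mem_union, or_imp, forall_and] using ⟨hS₁, hS₂⟩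
    · simpa only [Finset.mem_union, or_imp, forall_and] using ⟨hT₁, hT₂⟩
    · exact H₁ φ hφ (fun s hs => hS s (Finset.mem_union_left _ hs))
        fun t ht => hT t (Finset.mem_union_left _ ht)
    · exact H₂ φ hφ (fun s hs => hS s (Finset.mem_union_right _ hs))
        fun t ht => hT t (Finset.mem_union_right _ ht)
  | or hφ hψ ih₁ ih₂ =>
    rcases BoundedFormula.realize_sup.1 hF with hF | hF
    · obtain ⟨S, T, hS, hT, H⟩ := ih₁ hmul.1.1 hF
      exact ⟨S, T, hS, hT, fun φ h1 h2 h3 =>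
        let := constantsOn.structure (imageValuation X φ)
        BoundedFormula.realize_sup.2 (Or.inl (H φ h1 h2 h3))⟩
    · obtain ⟨S, T, hS, hT, H⟩ := ih₂ hmul.2 hF
      exact ⟨S, T, hS, hT, fun φ h1 h2 h3 =>
        let := constantsOn.structure (imageValuation X φ)
        BoundedFormula.realize_sup.2 (Or.inr (H φ h1 h2 h3))⟩

end Evaluation

/-! ### Comparison of the three notions of satisfiability -/

section Satisfiability

variable {X : Type u} {F : (sig[[X]]).Sentence}

lemma SatisfiableModulo.mono {T T' : sig.Theory} (h : T ⊆ T') (hF : SatisfiableModulo T' F) :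
    SatisfiableModulo T F :=
  Theory.IsSatisfiable.mono hF (Set.union_subset_union_left _ (Set.image_mono h))

lemma LIRR_subset_realTheory : LIRR ⊆ realTheory := fun φ hφ =>
  (mem_completeTheory).2 (Theory.model_iff _ |>.1 real_models_LIRR φ hφ)

lemma SatisfiableInReals.satisfiableModulo (hF : SatisfiableInReals F) :
    SatisfiableModulo realTheory F := by
  obtain ⟨v, hv⟩ := hF
  let := constantsOn.structure v
  have h1 : ℝ ⊨ (sig.lhomWithConstants X).onTheory realTheory :=
    (LHom.onTheory_model _ _).2 (Theory.model_iff _ |>.2 fun _ => mem_completeTheory.1)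
  have h2 : ℝ ⊨ (sig.lhomWithConstants X).onTheory realTheory ∪ {F} :=
    Theory.model_union_iff.2 ⟨h1, Theory.model_singleton_iff.2 hv⟩
  exact Theory.Model.isSatisfiable ℝ

lemma SatisfiableModulo.satisfiableInReals (hneg : IsQFNegFree F) (hmul : MulFree F)
    (hF : SatisfiableModulo LIRR F) : SatisfiableInReals F := by
  obtain ⟨M⟩ := hF
  let : sig.Structure M := (sig.lhomWithConstants X).reduct M
  have : (sig.lhomWithConstants X).IsExpansionOn M := LHom.isExpansionOn_reduct _ _
  obtain ⟨h1, h2⟩ := Theory.model_union_iff.1 M.is_model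
  have hM : M ⊨ LIRR := (LHom.onTheory_model _ _).1 h1
  obtain ⟨_, _, I, hc⟩ := exists_compatible_commRing M
    (hM.mono fun φ hφ => Or.inl (Or.inl (Or.inl (Or.inl (Or.inl hφ)))))
  have h := hc.models_LIRR_iff.1 hM
  obtain ⟨_⟩ := h.nonempty_algebraRat
  obtain ⟨S, T, hS, hT, H⟩ := exists_finset_realize h hc hneg hmul default default
    (Theory.model_singleton_iff.1 h2)
  obtain ⟨φ, h3, h4, h5⟩ := h.isCuttingCone.exists_linearMap h.int_one S T hS hT
  refine ⟨imageValuation X φ, ?_⟩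
  let := constantsOn.structure (imageValuation X φ)
  have := H φ h3 h4 h5
  -- A sentence has no free variables, so the two valuations are functions on empty types and agree.
  change BoundedFormula.Realize F _ _
  convert this

end Satisfiability

end LIRing

theorem mainTheorem8 {X : Type*} (F : (LIRing.sig.withConstants X).Sentence)
    (hneg : LIRing.IsQFNegFree F) (hmul : LIRing.MulFree F) :
    (LIRing.SatisfiableModulo LIRing.LIRR F ↔ LIRing.SatisfiableModulo LIRing.realTheory F) ∧
      (LIRing.SatisfiableModulo LIRing.LIRR F ↔ LIRing.SatisfiableInReals F) :=
  ⟨⟨fun h => (h.satisfiableInReals hneg hmul).satisfiableModulo,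
    fun h => h.mono LIRing.LIRR_subset_realTheory⟩,
    fun h => h.satisfiableInReals hneg hmul,
    fun h => h.satisfiableModulo.mono LIRing.LIRR_subset_realTheory⟩
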